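/- Let $X=(X_t)_{t\ge 0}$ be a nonnegative adapted process on a filtered probability space $(\Omega,\mathcal F,(\mathcal F_t)_{t\ge 0},\mathbb P^*)$ such that $X_0=x_0$ almost surely for some $x_0>0$, $\mathbb E^*[X_t]<\infty$ for all $t$, and $(e^{-rt}X_t)_{t\ge 0}$ is a martingale, where $r\ge 0$ is the interest rate. Let $C(T,K)=e^{-rT}\,\mathbb E^*[(X_T-K)^+]$ be the corresponding call pricing function, and suppose that $C\in PF_\infty$, i.e. $C(T,K)>0$ for all $T>0$ and all $K>0$ with $K\ge x_0e^{rT}$. Fix $T>0$, write $C(K)=C(T,K)$, and let $I(K)$ be the implied volatility, i.e. the unique $\sigma>0$ with $C(T,K)=C_{BS}(T,K,\sigma)$, which exists for $K\ge x_0e^{rT}$. Here $$C_{BS}(T,K,\sigma)=x_0N(d_1)-Ke^{-rT}N(d_2),\qquad d_1=\frac{\log x_0-\log K+(r+\frac12\sigma^2)T}{\sigma\sqrt T},\qquad d_2=d_1-\sigma\sqrt T,$$ and $N$ is the standard normal distribution function. Put $\tilde p=\sup\{p\ge 0:\mathbb E^*[X_T^{1+p}]<\infty\}$ and $\psi(u)=2-4(\sqrt{u^2+u}-u)$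 for $u\ge 0$. Suppose that $0<\tilde p<\infty$. Then $$I(K)\sim\left(\frac{\psi(\tilde p)}{T}\right)^{1/2}\sqrt{\log K}\qquad (K\to\infty),$$ in the sense that the ratio of the two sides tends to $1$, if and only if $C$ is of weak Pareto type near infinity with index $-\tilde p$. The last condition means the following. A function $F$ is of weak Pareto type near infinity with index $\alpha$ if it is positive and Lebesgue measurable on some $(c,\infty)$ with $c\ge 0$, and if there are positive functions $f_1,f_2\in R_\alpha$ and a number $y_0$ such that $f_1(y)\le F(y)\le f_2(y)$ for all $y>y_0$. Here $R_\alpha$ is the class of functions $f$ that are defined and Lebesgue measurable on a neighborhood of infinity and satisfy $f(\lambda x)/f(x)\to\lambda^\alpha$ as $x\to\infty$ for every $\lambda>0$. -/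

import Mathlib

open MeasureTheory ProbabilityTheory Filter Topology Asymptotics
open scoped NNReal ENNReal

namespace OptionPricing

/-- The standing assumptions on the stock price: `X` is a nonnegative adapted process on the
filtered probability space `(Ω, ℱ, μ)`, it starts at `x₀ > 0` almost surely, every `X t` has a
finite expectation, and `μ` is a risk-free measure, that is, for the interest rate `r ≥ 0` the
discounted price `t ↦ e^{-rt} X_t` is a martingale. -/
structure IsStockPrice {Ω : Type*} {m : MeasurableSpace Ω} (μ : Measure Ω)
    (ℱ : Filtration ℝ≥0 m) (r x₀ : ℝ) (X : ℝ≥0 → Ω → ℝ) : Prop where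
  rate_nonneg : 0 ≤ r
  spot_pos : 0 < x₀
  nonneg : ∀ t ω, 0 ≤ X t ω
  adapted : StronglyAdapted ℱ X
  initial : ∀ᵐ ω ∂μ, X 0 ω = x₀
  integrable : ∀ t, Integrable (X t) μ
  martingale : Martingale (fun (t : ℝ≥0) ω => Real.exp (-r * t) * X t ω) ℱ μ

/-- The European call pricing function `C(T, K) = e^{-rT} E[(X_T - K)⁺]`. -/
noncomputable def callPrice {Ω : Type*} {m : MeasurableSpace Ω} (μ : Measure Ω) (r : ℝ)
    (X : ℝ≥0 → Ω → ℝ) (T : ℝ≥0) (K : ℝ) : ℝ :=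
  Real.exp (-r * T) * ∫ ω, max (X T ω - K) 0 ∂μ

/-- The class `PF_∞`: a call pricing function `C` belongs to it if `C(T, K) > 0` for all `T > 0`
and all `K > 0` with `x₀ e^{rT} ≤ K`. -/
def MemPFInfty (r x₀ : ℝ) (C : ℝ≥0 → ℝ → ℝ) : Prop :=
  ∀ T : ℝ≥0, 0 < T → ∀ K : ℝ, 0 < K → x₀ * Real.exp (r * T) ≤ K → 0 < C T K

/-- The standard normal distribution function. -/
noncomputable def stdNormalCDF (z : ℝ) : ℝ :=
  1 / √(2 * Real.pi) * ∫ y in Set.Iic z, Real.exp (-(y ^ 2) / 2)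

/-- The quantity `d₁(K, σ)` of the Black-Scholes formula. -/
noncomputable def bsD1 (r x₀ T K σ : ℝ) : ℝ :=
  (Real.log x₀ - Real.log K + (r + 1 / 2 * σ ^ 2) * T) / (σ * √T)

/-- The quantity `d₂(K, σ)` of the Black-Scholes formula. -/
noncomputable def bsD2 (r x₀ T K σ : ℝ) : ℝ :=
  bsD1 r x₀ T K σ - σ * √T

/-- The Black-Scholes call price `C_BS(T, K, σ)`. -/
noncomputable def bsCall (r x₀ T K σ : ℝ) : ℝ :=
  x₀ * stdNormalCDF (bsD1 r x₀ T K σ)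
    - K * Real.exp (-r * T) * stdNormalCDF (bsD2 r x₀ T K σ)

open Classical in
/-- The implied volatility `I(T, K)` of a call pricing function `C`: the volatility `σ > 0` with
`C(T, K) = C_BS(T, K, σ)`, when such a `σ` exists and is unique. Where it is undefined, the value
is set to `0`, which is never a value of the implied volatility. -/
noncomputable def impliedVol (r x₀ : ℝ) (C : ℝ≥0 → ℝ → ℝ) (T : ℝ≥0) (K : ℝ) : ℝ :=
  if h : ∃! σ : ℝ, 0 < σ ∧ C T K = bsCall r x₀ T K σ then h.exists.choose else 0

/-- The function `ψ(u) = 2 - 4 (√(u² + u) - u)`, `u ≥ 0`. -/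
noncomputable def leePsi (u : ℝ) : ℝ :=
  2 - 4 * (√(u ^ 2 + u) - u)

/-- The critical exponent `p̃ = sup {p ≥ 0 : E[X_T^{1+p}] < ∞}`, with values in `[0, ∞]`, of the
nonnegative random variable `Y = X_T`. -/
noncomputable def criticalMoment {Ω : Type*} {m : MeasurableSpace Ω} (μ : Measure Ω)
    (Y : Ω → ℝ) : ℝ≥0∞ :=
  ⨆ (p : ℝ≥0) (_ : ∫⁻ ω, ENNReal.ofReal (Y ω ^ (1 + (p : ℝ))) ∂μ < ∞), (p : ℝ≥0∞)

/-- `f` is Lebesgue measurable on some neighborhood of infinity and regularly varying with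
index `α`: `f (λ x) / f x → λ ^ α` as `x → ∞`, for every `λ > 0`.
(For real-valued functions Lebesgue measurability on a set is the same as
`AEMeasurable` for the restriction of `volume` to that set. Only the values of `f` near infinity
matter, so `f` is taken to be a total function.) -/
def RegularlyVarying (α : ℝ) (f : ℝ → ℝ) : Prop :=
  (∃ a : ℝ, AEMeasurable f (volume.restrict (Set.Ioi a))) ∧
    ∀ l : ℝ, 0 < l → Tendsto (fun x => f (l * x) / f x) atTop (𝓝 (l ^ α))

/-- `F` is of weak Pareto type near infinity with index `α`: it is positive and Lebesgue
measurable on some `(c, ∞)`, `c ≥ 0`, and it lies, near infinity, between two positive regularly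
varying functions with index `α`. -/
def WeakParetoAtInfty (α : ℝ) (F : ℝ → ℝ) : Prop :=
  (∃ c : ℝ, 0 ≤ c ∧ AEMeasurable F (volume.restrict (Set.Ioi c)) ∧ ∀ y, c < y → 0 < F y) ∧
    ∃ f₁ f₂ : ℝ → ℝ, RegularlyVarying α f₁ ∧ RegularlyVarying α f₂ ∧
      ∃ y₀ : ℝ, ∀ y, y₀ < y → 0 < f₁ y ∧ 0 < f₂ y ∧ f₁ y ≤ F y ∧ F y ≤ f₂ y

end OptionPricing

open OptionPricing

/-!
For every number `p > 0` both conditions are equivalent to `C(K) = K^{-p + o(1)}`, that is, to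
`log C(K) / log K → -p`.

*Implied volatility.* Along the volatilities `σ_v(K)` with `σ² T = v log K`, `0 < v < 2`, the
Black-Scholes price is `K^{-u(v) + o(1)}` with `u(v) = (2 - v)² / (8 v)`
(`eventually_bsCall_wingVol_lt`, `eventually_lt_bsCall_wingVol`). The upper bound is
`C_BS ≤ x₀ N(d₁)` and a Gaussian tail estimate, the lower bound applies the mean value
theorem on `[σ_w, σ_v]`, `w` slightly below `v`, with the vega `x₀ √T φ(d₁)`.
The function `u` is strictly decreasing on `(0, 2)` and `u(ψ(p)) = p`. As the Black-Scholes price is strictly increasing in `σ`, comparing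
`C(K)` with the prices at `σ_v(K)` for `v` on either side of `ψ(p)` gives
`I(K)² T / log K → ψ(p)` if and only if `log C(K) / log K → -p` (`tendsto_totalVariance_iff`).
The intermediate value theorem yields the existence of the implied volatility for large `K`.

*Weak Pareto type.* Since `C` is antitone, its exponent is determined by the values at `K = e^n`,
where it is squeezed between those of `f₁` and `f₂`; these converge by a Cesàro argument applied to
`log f(e^{n+1}) - log f(e^n)`. Conversely, if `C(K) = K^{-p} exp(h(log K))` with `h(u) = o(u)`,
then `|h|` lies below a function `g` with `g(u + c) - g(u) → 0` (`exists_continuous_majorant`), and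
`K^{-p} exp(± g(log K))` are regularly varying bounds (`weakParetoAtInfty_iff`).
-/

namespace OptionPricing

/-! ### The standard normal distribution function -/

lemma integrable_exp_neg_sq_div_two : Integrable fun y : ℝ => Real.exp (-(y ^ 2) / 2) := by
  refine (integrable_exp_neg_mul_sq (b := 1 / 2) (by norm_num)).congr (ae_of_all _ fun y => ?_)
  simp only
  congr 1
  ring

lemma integral_exp_neg_sq_div_two : ∫ y : ℝ, Real.exp (-(y ^ 2) / 2) = √(2 * Real.pi) := by
  have h := integral_gaussian (1 / 2)
  rw [show Real.pi / (1 / 2) = 2 * Real.pi by ring] at h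
  rw [← h]
  congr 1 with y
  congr 1
  ring

lemma hasDerivAt_stdNormalCDF (z : ℝ) :
    HasDerivAt stdNormalCDF (1 / √(2 * Real.pi) * Real.exp (-(z ^ 2) / 2)) z := by
  have hc : Continuous fun y : ℝ => Real.exp (-(y ^ 2) / 2) := by fun_prop
  have hF : stdNormalCDF = fun z => 1 / √(2 * Real.pi) *
      ((∫ y in Set.Iic 0, Real.exp (-(y ^ 2) / 2)) + ∫ y in (0 : ℝ)..z, Real.exp (-(y ^ 2) / 2)) := by
    funext z
    rw [← intervalIntegral.integral_Iic_sub_Iic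
      integrable_exp_neg_sq_div_two.integrableOn integrable_exp_neg_sq_div_two.integrableOn]
    simp [stdNormalCDF]
  rw [hF]
  exact ((intervalIntegral.integral_hasDerivAt_right (hc.intervalIntegrable _ _)
    (hc.stronglyMeasurableAtFilter _ _) hc.continuousAt).const_add _).const_mul _

lemma stdNormalCDF_nonneg (z : ℝ) : 0 ≤ stdNormalCDF z :=
  mul_nonneg (by positivity) (integral_nonneg fun _ => (Real.exp_pos _).le)

lemma stdNormalCDF_le_exp {z : ℝ} (hz : z ≤ 0) : stdNormalCDF z ≤ Real.exp (-(z ^ 2) / 2) := by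
  have hi : Integrable fun y : ℝ => Real.exp (-(z ^ 2) / 2) * Real.exp (-((y - z) ^ 2) / 2) :=
    (integrable_exp_neg_sq_div_two.comp_sub_right z).const_mul _
  have h : ∫ y in Set.Iic z, Real.exp (-(y ^ 2) / 2)
      ≤ Real.exp (-(z ^ 2) / 2) * √(2 * Real.pi) := by
    calc ∫ y in Set.Iic z, Real.exp (-(y ^ 2) / 2)
        ≤ ∫ y in Set.Iic z, Real.exp (-(z ^ 2) / 2) * Real.exp (-((y - z) ^ 2) / 2) := by
          refine setIntegral_mono_on integrable_exp_neg_sq_div_two.integrableOn hi.integrableOn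
            measurableSet_Iic fun y hy => ?_
          rw [← Real.exp_add]
          refine Real.exp_le_exp.2 ?_
          nlinarith [mul_nonneg_of_nonpos_of_nonpos hz (sub_nonpos.2 (Set.mem_Iic.1 hy))]
      _ ≤ ∫ y, Real.exp (-(z ^ 2) / 2) * Real.exp (-((y - z) ^ 2) / 2) :=
          setIntegral_le_integral hi (ae_of_all _ fun y => by positivity)
      _ = Real.exp (-(z ^ 2) / 2) * √(2 * Real.pi) := by
          rw [integral_const_mul,
            integral_sub_right_eq_self (fun y : ℝ => Real.exp (-(y ^ 2) / 2)) z,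
            integral_exp_neg_sq_div_two]
  have h2 : 0 < √(2 * Real.pi) := by positivity
  rw [stdNormalCDF, one_div, inv_mul_le_iff₀ h2]
  linarith

/-! ### Monotonicity of the Black-Scholes price in the volatility -/

/-- The relation `x₀ φ(d₁) = K e^{-rT} φ(d₂)` between the two normal densities. -/
lemma spot_mul_exp_bsD1 {r x₀ T K σ : ℝ} (hx : 0 < x₀) (hT : 0 < T) (hK : 0 < K) (hσ : 0 < σ) :
    x₀ * Real.exp (-(bsD1 r x₀ T K σ ^ 2) / 2)
      = K * Real.exp (-r * T) * Real.exp (-(bsD2 r x₀ T K σ ^ 2) / 2) := by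
  have hs : √T ^ 2 = T := Real.sq_sqrt hT.le
  have hs0 : 0 < √T := Real.sqrt_pos.2 hT
  have hd : bsD1 r x₀ T K σ * (σ * √T) = Real.log x₀ - Real.log K + (r + 1 / 2 * σ ^ 2) * T :=
    div_mul_cancel₀ _ (by positivity)
  have hexp : Real.log x₀ + -(bsD1 r x₀ T K σ ^ 2) / 2
      = Real.log K + -r * T + -(bsD2 r x₀ T K σ ^ 2) / 2 := by
    rw [bsD2]
    linear_combination -hd + σ ^ 2 / 2 * hs
  have h := congrArg Real.exp hexp
  rwa [Real.exp_add, Real.exp_add, Real.exp_add, Real.exp_log hx, Real.exp_log hK] at h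

/-- The vega of a call: `∂C_BS/∂σ = x₀ √T φ(d₁)`. -/
lemma hasDerivAt_bsCall {r x₀ T K σ : ℝ} (hx : 0 < x₀) (hT : 0 < T) (hK : 0 < K) (hσ : 0 < σ) :
    HasDerivAt (bsCall r x₀ T K)
      (x₀ * √T / √(2 * Real.pi) * Real.exp (-(bsD1 r x₀ T K σ ^ 2) / 2)) σ := by
  have hs0 : 0 < √T := Real.sqrt_pos.2 hT
  obtain ⟨a, ha⟩ : ∃ a, HasDerivAt (bsD1 r x₀ T K) a σ := by
    refine ⟨_, DifferentiableAt.hasDerivAt ?_⟩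
    unfold bsD1
    have : σ * √T ≠ 0 := by positivity
    fun_prop (disch := assumption)
  have hb : HasDerivAt (bsD2 r x₀ T K) (a - 1 * √T) σ :=
    ha.sub ((hasDerivAt_id σ).mul_const (√T))
  have h := (((hasDerivAt_stdNormalCDF _).comp σ ha).const_mul x₀).sub
    (((hasDerivAt_stdNormalCDF _).comp σ hb).const_mul (K * Real.exp (-r * T)))
  refine h.congr_deriv ?_
  have := spot_mul_exp_bsD1 (r := r) hx hT hK hσ
  linear_combination ((a - √T) / √(2 * Real.pi)) * this

lemma continuousOn_bsCall {r x₀ T K : ℝ} (hx : 0 < x₀) (hT : 0 < T) (hK : 0 < K) :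
    ContinuousOn (bsCall r x₀ T K) (Set.Ioi 0) :=
  fun _ hσ => (hasDerivAt_bsCall hx hT hK hσ).continuousAt.continuousWithinAt

lemma strictMonoOn_bsCall {r x₀ T K : ℝ} (hx : 0 < x₀) (hT : 0 < T) (hK : 0 < K) :
    StrictMonoOn (bsCall r x₀ T K) (Set.Ioi 0) := by
  refine strictMonoOn_of_hasDerivWithinAt_pos (convex_Ioi 0) (continuousOn_bsCall hx hT hK)
    (fun σ hσ => (hasDerivAt_bsCall hx hT hK ?_).hasDerivWithinAt) fun σ hσ => ?_
  · simpa using hσ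
  · have : 0 < √T := Real.sqrt_pos.2 hT
    positivity

/-- For an out-of-the-money strike both `d₁` and `d₂` tend to `-∞` as `σ ↓ 0`, so the increasing
function `σ ↦ C_BS(T, K, σ)` starts at `0`. -/
lemma bsCall_nonneg {r x₀ T K σ : ℝ} (hx : 0 < x₀) (hT : 0 < T) (hK : 0 < K) (hσ : 0 < σ)
    (hKx : Real.log x₀ + r * T < Real.log K) : 0 ≤ bsCall r x₀ T K σ := by
  have hs0 : 0 < √T := Real.sqrt_pos.2 hT
  have hs : √T ^ 2 = T := Real.sq_sqrt hT.le
  set A := (Real.log x₀ + r * T - Real.log K) / √T with hA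
  have hA0 : A < 0 := div_neg_of_neg_of_pos (by linarith) hs0
  have hd2 : ∀ s : ℝ, 0 < s → bsD2 r x₀ T K s ≤ A * s⁻¹ := by
    intro s hs'
    have : bsD2 r x₀ T K s = A * s⁻¹ - s * √T / 2 := by
      rw [bsD2, bsD1, hA]
      field_simp
      rw [hs]
      ring
    rw [this]
    linarith [mul_pos hs' hs0]
  have hlim : Tendsto (fun s => K * Real.exp (-r * T) * Real.exp (-(bsD2 r x₀ T K s ^ 2) / 2))
      (𝓝[>] 0) (𝓝 0) := by
    have h1 : Tendsto (bsD2 r x₀ T K) (𝓝[>] 0) atBot :=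
      tendsto_atBot_mono' _ (eventually_nhdsWithin_of_forall hd2)
        (tendsto_inv_nhdsGT_zero.const_mul_atTop_of_neg hA0)
    have hsq : Tendsto (fun s => bsD2 r x₀ T K s ^ 2) (𝓝[>] 0) atTop := by
      simpa only [Function.comp_def, sq_abs] using
        (tendsto_pow_atTop two_ne_zero).comp (tendsto_abs_atBot_atTop.comp h1)
    have h2 : Tendsto (fun s => -(bsD2 r x₀ T K s ^ 2) / 2) (𝓝[>] 0) atBot :=
      (tendsto_neg_atTop_atBot.comp hsq).atBot_div_const two_pos
    simpa using (Real.tendsto_exp_atBot.comp h2).const_mul (K * Real.exp (-r * T))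
  have hlim' := hlim.neg
  rw [neg_zero] at hlim'
  refine le_of_tendsto hlim' ?_
  filter_upwards [self_mem_nhdsWithin, Ioo_mem_nhdsGT hσ] with s hs1 hs2
  have h0 := strictMonoOn_bsCall (r := r) hx hT hK hs1 hσ hs2.2
  have h1 : stdNormalCDF (bsD2 r x₀ T K s) ≤ _ := stdNormalCDF_le_exp
    ((hd2 s hs1).trans (mul_nonpos_of_nonpos_of_nonneg hA0.le (inv_pos.2 hs1).le))
  have h2 : -(K * Real.exp (-r * T) * stdNormalCDF (bsD2 r x₀ T K s)) ≤ bsCall r x₀ T K s := by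
    rw [bsCall]
    linarith [mul_nonneg hx.le (stdNormalCDF_nonneg (bsD1 r x₀ T K s))]
  have h3 := mul_le_mul_of_nonneg_left h1 (by positivity : 0 ≤ K * Real.exp (-r * T))
  linarith

/-! ### Exponential rate of the Black-Scholes price for large strikes -/

/-- The exponent `(2 - v)² / (8 v)`: along the volatilities with `σ² T = v log K`, the
Black-Scholes price decays like this negative power of `K`, up to factors `K^{o(1)}`. -/
noncomputable def bsRate (v : ℝ) : ℝ := (2 - v) ^ 2 / (8 * v)

lemma bsRate_strictAntiOn : StrictAntiOn bsRate (Set.Ioo 0 2) := by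
  rintro v ⟨hv, hv2⟩ w ⟨hw, hw2⟩ hvw
  unfold bsRate
  apply div_lt_div₀ _ _ _ _ <;> nlinarith

lemma continuousAt_bsRate {v : ℝ} (hv : 0 < v) : ContinuousAt bsRate v := by
  unfold bsRate
  have : 8 * v ≠ 0 := by positivity
  fun_prop (disch := assumption)

lemma leePsi_mem_Ioo {p : ℝ} (hp : 0 < p) : leePsi p ∈ Set.Ioo 0 2 := by
  have h1 : √(p ^ 2 + p) < p + 1 / 2 := (Real.sqrt_lt' (by linarith)).2 (by nlinarith)
  have h2 : p < √(p ^ 2 + p) := Real.lt_sqrt_of_sq_lt (by linarith)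
  constructor <;> unfold leePsi <;> linarith

/-- On `(0, ∞)`, `leePsi` is a right inverse of `bsRate`. -/
lemma bsRate_leePsi {p : ℝ} (hp : 0 < p) : bsRate (leePsi p) = p := by
  have h0 := (leePsi_mem_Ioo hp).1
  have hs : √(p ^ 2 + p) ^ 2 = p ^ 2 + p := Real.sq_sqrt (by positivity)
  rw [bsRate, div_eq_iff (by positivity), leePsi]
  linear_combination 16 * hs

/-- The volatility `σ` with `σ² T = v log K`. -/
noncomputable def wingVol (T v K : ℝ) : ℝ := √(v * Real.log K / T)

lemma bsD1_wingVol {r x₀ T K v : ℝ} (hT : 0 < T) (hv : 0 < v) (hK : 0 < Real.log K) :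
    bsD1 r x₀ T K (wingVol T v K)
      = (Real.log x₀ + r * T - (1 - v / 2) * Real.log K) / √(v * Real.log K) := by
  have h1 : wingVol T v K * √T = √(v * Real.log K) := by
    rw [wingVol, ← Real.sqrt_mul (by positivity), div_mul_cancel₀ _ hT.ne']
  have h2 : wingVol T v K ^ 2 = v * Real.log K / T := Real.sq_sqrt (by positivity)
  rw [bsD1, h1, h2]
  congr 1
  field_simp
  ring

lemma tendsto_sq_bsD1_wingVol {r x₀ T v : ℝ} (hT : 0 < T) (hv : 0 < v) :
    Tendsto (fun K => bsD1 r x₀ T K (wingVol T v K) ^ 2 / 2 / Real.log K) atTop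
      (𝓝 (bsRate v)) := by
  have h : Tendsto (fun K => ((Real.log x₀ + r * T) / Real.log K - (1 - v / 2)) ^ 2 / (2 * v))
      atTop (𝓝 ((0 - (1 - v / 2)) ^ 2 / (2 * v))) :=
    (((Real.tendsto_log_atTop.const_div_atTop _).sub_const _).pow 2).div_const _
  have hv' : (0 - (1 - v / 2)) ^ 2 / (2 * v) = bsRate v := by
    rw [bsRate]
    field_simp
    ring
  rw [hv'] at h
  refine h.congr' ?_
  filter_upwards [Real.tendsto_log_atTop.eventually_gt_atTop 0] with K hK
  rw [bsD1_wingVol hT hv hK, div_pow _ (√_), Real.sq_sqrt (by positivity)]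
  field_simp

lemma eventually_bsD1_wingVol_neg {r x₀ T v : ℝ} (hT : 0 < T) (hv : 0 < v) (hv2 : v < 2) :
    ∀ᶠ K in atTop, bsD1 r x₀ T K (wingVol T v K) < 0 := by
  have h := Real.tendsto_log_atTop.const_mul_atTop (show 0 < 1 - v / 2 by linarith)
  filter_upwards [Real.tendsto_log_atTop.eventually_gt_atTop 0,
    h.eventually_gt_atTop (Real.log x₀ + r * T)] with K hK h
  rw [bsD1_wingVol hT hv hK]
  exact div_neg_of_neg_of_pos (by linarith) (by positivity)

lemma wingVol_pos {T v K : ℝ} (hT : 0 < T) (hv : 0 < v) (hK : 0 < Real.log K) :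
    0 < wingVol T v K := Real.sqrt_pos.2 (by positivity)

lemma eventually_bsCall_wingVol_lt {r x₀ T v q : ℝ} (hx : 0 < x₀) (hT : 0 < T) (hv : 0 < v)
    (hv2 : v < 2) (hq : q < bsRate v) :
    ∀ᶠ K in atTop, bsCall r x₀ T K (wingVol T v K) < Real.exp (-q * Real.log K) := by
  have hlim := ((Real.tendsto_log_atTop.const_div_atTop (Real.log x₀)).sub
    (tendsto_sq_bsD1_wingVol (r := r) (x₀ := x₀) hT hv)).eventually_lt_const
      (show 0 - bsRate v < -q by linarith)
  filter_upwards [Real.tendsto_log_atTop.eventually_gt_atTop 0, eventually_gt_atTop 0,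
    eventually_bsD1_wingVol_neg (r := r) (x₀ := x₀) hT hv hv2, hlim] with K hK hK0 hd hl
  set d := bsD1 r x₀ T K (wingVol T v K) with hd_def
  rw [← sub_div, div_lt_iff₀ hK] at hl
  calc bsCall r x₀ T K (wingVol T v K) ≤ x₀ * stdNormalCDF d := by
        rw [bsCall]
        linarith [mul_nonneg (by positivity : 0 ≤ K * Real.exp (-r * T))
          (stdNormalCDF_nonneg (bsD2 r x₀ T K (wingVol T v K)))]
    _ ≤ x₀ * Real.exp (-(d ^ 2) / 2) := by
        gcongr
        exact stdNormalCDF_le_exp hd.le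
    _ = Real.exp (Real.log x₀ - d ^ 2 / 2) := by
        nth_rewrite 1 [← Real.exp_log hx]
        rw [← Real.exp_add]
        congr 1
        ring
    _ < _ := Real.exp_lt_exp.2 hl

lemma eventually_lt_bsCall_wingVol {r x₀ T v q : ℝ} (hx : 0 < x₀) (hT : 0 < T) (hv : 0 < v)
    (hv2 : v < 2) (hq : bsRate v < q) :
    ∀ᶠ K in atTop, Real.exp (-q * Real.log K) < bsCall r x₀ T K (wingVol T v K) := by
  -- The increment of the price over the interval between the volatilities of `w` and `v`,
  -- with `w < v` close to `v`, is already large enough, by the mean value theorem.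
  obtain ⟨w, hwq, hw0, hwv⟩ : ∃ w, bsRate w < q ∧ 0 < w ∧ w < v := by
    have h1 : ∀ᶠ w in 𝓝[<] v, bsRate w < q :=
      ((continuousAt_bsRate hv).eventually_lt_const hq).filter_mono nhdsWithin_le_nhds
    obtain ⟨w, hw, hw'⟩ := (h1.and (Ioo_mem_nhdsLT hv)).exists
    exact ⟨w, hw, hw'.1, hw'.2⟩
  have hs0 : 0 < √T := Real.sqrt_pos.2 hT
  set κ := (√(v / T) - √(w / T)) * (x₀ * √T / √(2 * Real.pi)) with hκ
  have hsq : √(w / T) < √(v / T) := Real.sqrt_lt_sqrt (by positivity) (by gcongr)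
  have hκ0 : 0 < κ := mul_pos (sub_pos.2 hsq) (by positivity)
  have hlim := ((Real.tendsto_log_atTop.const_div_atTop (Real.log κ)).sub
    (tendsto_sq_bsD1_wingVol (r := r) (x₀ := x₀) hT hw0)).eventually_const_lt
      (show -q < 0 - bsRate w by linarith)
  filter_upwards [Real.tendsto_log_atTop.eventually_ge_atTop 1, eventually_gt_atTop 0,
    Real.tendsto_log_atTop.eventually_gt_atTop (Real.log x₀ + r * T),
    eventually_bsD1_wingVol_neg (r := r) (x₀ := x₀) hT hv hv2, hlim] with K hK hK0 hKx hd hl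
  have hK' : 0 < Real.log K := by linarith
  set d := bsD1 r x₀ T K (wingVol T w K) with hd_def
  rw [← sub_div, lt_div_iff₀ hK'] at hl
  have hσw := wingVol_pos hT hw0 hK'
  have hσv := wingVol_pos hT hv hK'
  have hmul : ∀ u, 0 < u → wingVol T u K = √(u / T) * √(Real.log K) := fun u hu => by
    rw [wingVol, ← Real.sqrt_mul (by positivity), div_mul_eq_mul_div]
  have hdiff : √(v / T) - √(w / T) ≤ wingVol T v K - wingVol T w K := by
    rw [hmul v hv, hmul w hw0, ← sub_mul]
    exact le_mul_of_one_le_right (sub_pos.2 hsq).le (Real.one_le_sqrt.2 hK)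
  have hwv' : wingVol T w K < wingVol T v K := by linarith
  obtain ⟨ξ, ⟨hξ1, hξ2⟩, hξ⟩ := exists_hasDerivAt_eq_slope (bsCall r x₀ T K) _ hwv'
    ((continuousOn_bsCall hx hT hK0).mono fun s hs => hσw.trans_le hs.1)
    fun s hs => hasDerivAt_bsCall (r := r) hx hT hK0 (hσw.trans hs.1)
  rw [eq_div_iff (by linarith)] at hξ
  -- `d₁` is nondecreasing in the volatility, and negative up to the volatility of `v`.
  have hform : ∀ s, 0 < s → bsD1 r x₀ T K s
      = (Real.log x₀ + r * T - Real.log K) / √T / s + s * √T / 2 := fun s hs => by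
    rw [bsD1]
    field_simp
    rw [Real.sq_sqrt hT.le]
    ring
  have hmono : ∀ s t, 0 < s → s ≤ t → bsD1 r x₀ T K s ≤ bsD1 r x₀ T K t := by
    intro s t hs hst
    rw [hform s hs, hform t (hs.trans_le hst)]
    have h1 : -((Real.log x₀ + r * T - Real.log K) / √T) / t
        ≤ -((Real.log x₀ + r * T - Real.log K) / √T) / s := by
      have : (Real.log x₀ + r * T - Real.log K) / √T ≤ 0 :=
        div_nonpos_of_nonpos_of_nonneg (by linarith) hs0.le
      exact div_le_div_of_nonneg_left (by linarith) hs hst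
    rw [neg_div, neg_div] at h1
    have h2 : s * √T ≤ t * √T := by gcongr
    linarith
  have hdξ : bsD1 r x₀ T K ξ ^ 2 ≤ d ^ 2 := by
    have h1 := hmono _ _ hσw hξ1.le
    have h2 := hmono _ _ (hσw.trans hξ1) hξ2.le
    nlinarith
  calc Real.exp (-q * Real.log K) < Real.exp (Real.log κ - d ^ 2 / 2) := Real.exp_lt_exp.2 hl
    _ = (√(v / T) - √(w / T)) * (x₀ * √T / √(2 * Real.pi) * Real.exp (-(d ^ 2) / 2)) := by
        rw [sub_eq_add_neg, Real.exp_add, Real.exp_log hκ0, ← neg_div, hκ, mul_assoc]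
    _ ≤ (wingVol T v K - wingVol T w K)
          * (x₀ * √T / √(2 * Real.pi) * Real.exp (-(bsD1 r x₀ T K ξ ^ 2) / 2)) := by
        gcongr
    _ = bsCall r x₀ T K (wingVol T v K) - bsCall r x₀ T K (wingVol T w K) := by
        rw [← hξ, mul_comm]
    _ ≤ _ := by linarith [bsCall_nonneg (r := r) hx hT hK0 hσw hKx]

/-! ### Implied volatility and the exponent of the call price -/

lemma impliedVol_nonneg (r x₀ : ℝ) (C : ℝ≥0 → ℝ → ℝ) (T : ℝ≥0) (K : ℝ) :
    0 ≤ impliedVol r x₀ C T K := by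
  unfold impliedVol
  split_ifs with h
  · exact h.exists.choose_spec.1.le
  · exact le_rfl

lemma bsCall_impliedVol {r x₀ K : ℝ} {C : ℝ≥0 → ℝ → ℝ} {T : ℝ≥0}
    (h : 0 < impliedVol r x₀ C T K) : C T K = bsCall r x₀ T K (impliedVol r x₀ C T K) := by
  unfold impliedVol at h ⊢
  split_ifs at h ⊢ with h'
  · exact h'.exists.choose_spec.2
  · exact absurd h (lt_irrefl _)

lemma impliedVol_mem_Ioo {r x₀ K σ₁ σ₂ : ℝ} {C : ℝ≥0 → ℝ → ℝ} {T : ℝ≥0} (hx : 0 < x₀)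
    (hT : 0 < T) (hK : 0 < K) (hσ₁ : 0 < σ₁) (hσ₂ : 0 < σ₂)
    (h₁ : bsCall r x₀ T K σ₁ < C T K) (h₂ : C T K < bsCall r x₀ T K σ₂) :
    impliedVol r x₀ C T K ∈ Set.Ioo σ₁ σ₂ := by
  have hmono := strictMonoOn_bsCall (r := r) hx (NNReal.coe_pos.2 hT) hK
  have h12 : σ₁ < σ₂ := (hmono.lt_iff_lt hσ₁ hσ₂).1 (h₁.trans h₂)
  obtain ⟨σ, hσ, hσC⟩ := intermediate_value_Ioo h12.le
    ((continuousOn_bsCall (r := r) hx (NNReal.coe_pos.2 hT) hK).mono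
      fun s hs => hσ₁.trans_le hs.1) ⟨h₁, h₂⟩
  have hσ0 : 0 < σ := hσ₁.trans hσ.1
  have hu : ∃! σ : ℝ, 0 < σ ∧ C T K = bsCall r x₀ T K σ :=
    ⟨σ, ⟨hσ0, hσC.symm⟩, fun s hs => hmono.injOn hs.1 hσ0 (hs.2.symm.trans hσC.symm)⟩
  have hI : impliedVol r x₀ C T K = σ := by
    rw [impliedVol, dif_pos hu]
    exact hu.unique hu.exists.choose_spec ⟨hσ0, hσC.symm⟩
  rwa [hI]

/-- The asymptotics of the implied volatility in terms of the total variance `I(K)² T`. -/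
lemma isEquivalent_iff_tendsto_totalVariance {I : ℝ → ℝ} (hI : ∀ K, 0 ≤ I K) {T v : ℝ}
    (hT : 0 < T) (hv : 0 < v) :
    IsEquivalent atTop I (fun K => (v / T) ^ (1 / 2 : ℝ) * √(Real.log K)) ↔
      Tendsto (fun K => I K ^ 2 * T / Real.log K) atTop (𝓝 v) := by
  have hlog := Real.tendsto_log_atTop.eventually_gt_atTop 0
  rw [← Real.sqrt_eq_rpow, isEquivalent_iff_tendsto_one]
  swap
  · filter_upwards [hlog] with K hK
    positivity
  constructor
  · intro h
    have h2 := (h.pow 2).const_mul v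
    rw [one_pow, mul_one] at h2
    refine h2.congr' ?_
    filter_upwards [hlog] with K hK
    rw [Pi.div_apply, div_pow, mul_pow, Real.sq_sqrt (by positivity), Real.sq_sqrt hK.le]
    field_simp
  · intro h
    have h2 := (h.div_const v).sqrt
    rw [div_self hv.ne', Real.sqrt_one] at h2
    refine h2.congr' ?_
    filter_upwards [hlog] with K hK
    rw [Pi.div_apply, Real.sqrt_eq_iff_mul_self_eq (by positivity)
      (div_nonneg (hI K) (by positivity)), ← pow_two, div_pow, mul_pow,
      Real.sq_sqrt (by positivity), Real.sq_sqrt hK.le]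
    field_simp

lemma wingVol_lt_iff {T v K σ : ℝ} (hT : 0 < T) (hv : 0 < v) (hK : 0 < Real.log K) (hσ : 0 ≤ σ) :
    wingVol T v K < σ ↔ v < σ ^ 2 * T / Real.log K := by
  rw [wingVol, Real.sqrt_lt (by positivity) hσ, div_lt_iff₀ hT, lt_div_iff₀ hK]

lemma lt_wingVol_iff {T v K σ : ℝ} (hT : 0 < T) (hK : 0 < Real.log K) (hσ : 0 ≤ σ) :
    σ < wingVol T v K ↔ σ ^ 2 * T / Real.log K < v := by
  rw [wingVol, Real.lt_sqrt hσ, lt_div_iff₀ hT, div_lt_iff₀ hK]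

/-- The total implied variance is asymptotic to `ψ(p) log K` if and only if the call price is
`K^{-p + o(1)}`. -/
lemma tendsto_totalVariance_iff {r x₀ p : ℝ} {C : ℝ≥0 → ℝ → ℝ} {T : ℝ≥0} (hx : 0 < x₀)
    (hT : 0 < T) (hp : 0 < p) (hC : ∀ᶠ K in atTop, 0 < C T K) :
    Tendsto (fun K => impliedVol r x₀ C T K ^ 2 * T / Real.log K) atTop (𝓝 (leePsi p)) ↔
      Tendsto (fun K => Real.log (C T K) / Real.log K) atTop (𝓝 (-p)) := by
  obtain ⟨hψ0, hψ2⟩ := leePsi_mem_Ioo hp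
  have hT' : (0 : ℝ) < T := NNReal.coe_pos.2 hT
  have hlog := Real.tendsto_log_atTop.eventually_gt_atTop 0
  have hrate := bsRate_leePsi hp
  constructor
  · intro h
    have hcont := continuousAt_bsRate hψ0
    rw [ContinuousAt, hrate] at hcont
    refine tendsto_order.2 ⟨fun a ha => ?_, fun a ha => ?_⟩
    · obtain ⟨v, hva, hv0, hvψ⟩ := (((hcont.eventually_lt_const
        (show p < -a by linarith)).filter_mono nhdsWithin_le_nhds).and (Ioo_mem_nhdsLT hψ0)).exists
      filter_upwards [hlog, hC, eventually_gt_atTop 0, h.eventually_const_lt hvψ,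
        eventually_lt_bsCall_wingVol (r := r) hx hT' hv0 (hvψ.trans hψ2) hva]
        with K hK hCK hK0 hJ hb
      rw [← wingVol_lt_iff hT' hv0 hK (impliedVol_nonneg ..)] at hJ
      have hw := wingVol_pos hT' hv0 hK
      have hb2 := strictMonoOn_bsCall (r := r) hx hT' hK0 hw (hw.trans hJ) hJ
      rw [← bsCall_impliedVol (hw.trans hJ)] at hb2
      rw [lt_div_iff₀ hK, Real.lt_log_iff_exp_lt hCK]
      simpa using hb.trans hb2
    · obtain ⟨v, hva, hvψ, hv2⟩ := (((hcont.eventually_const_lt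
        (show -a < p by linarith)).filter_mono nhdsWithin_le_nhds).and (Ioo_mem_nhdsGT hψ2)).exists
      have hv0 := hψ0.trans hvψ
      filter_upwards [hlog, hC, eventually_gt_atTop 0, h.eventually_lt_const hvψ,
        h.eventually_const_lt hψ0,
        eventually_bsCall_wingVol_lt (r := r) hx hT' hv0 hv2 hva]
        with K hK hCK hK0 hJ hJ0 hb
      rw [← lt_wingVol_iff hT' hK (impliedVol_nonneg ..)] at hJ
      have hI : 0 < impliedVol r x₀ C T K := by
        refine (impliedVol_nonneg r x₀ C T K).lt_of_ne fun h0 => ?_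
        rw [← h0] at hJ0
        simp at hJ0
      have hb2 := strictMonoOn_bsCall (r := r) hx hT' hK0 hI (wingVol_pos hT' hv0 hK) hJ
      rw [← bsCall_impliedVol hI] at hb2
      rw [div_lt_iff₀ hK, Real.log_lt_iff_lt_exp hCK]
      simpa using hb2.trans hb
  · intro h
    have key : ∀ v₁ ∈ Set.Ioo 0 (leePsi p), ∀ v₂ ∈ Set.Ioo (leePsi p) 2, ∀ᶠ K in atTop,
        impliedVol r x₀ C T K ^ 2 * T / Real.log K ∈ Set.Ioo v₁ v₂ := by
      rintro v₁ ⟨hv₁, hv₁ψ⟩ v₂ ⟨hv₂ψ, hv₂⟩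
      have hr₁ := bsRate_strictAntiOn ⟨hv₁, hv₁ψ.trans hψ2⟩ ⟨hψ0, hψ2⟩ hv₁ψ
      have hr₂ := bsRate_strictAntiOn ⟨hψ0, hψ2⟩ ⟨hψ0.trans hv₂ψ, hv₂⟩ hv₂ψ
      rw [hrate] at hr₁ hr₂
      obtain ⟨q₁, hq₁, hq₁'⟩ := exists_between hr₁
      obtain ⟨q₂, hq₂, hq₂'⟩ := exists_between hr₂
      filter_upwards [hlog, hC, eventually_gt_atTop 0,
        eventually_bsCall_wingVol_lt (r := r) hx hT' hv₁ (hv₁ψ.trans hψ2) hq₁',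
        eventually_lt_bsCall_wingVol (r := r) hx hT' (hψ0.trans hv₂ψ) hv₂ hq₂,
        h.eventually_const_lt (neg_lt_neg hq₁), h.eventually_lt_const (neg_lt_neg hq₂')]
        with K hK hCK hK0 hb₁ hb₂ hc₁ hc₂
      rw [lt_div_iff₀ hK, Real.lt_log_iff_exp_lt hCK] at hc₁
      rw [div_lt_iff₀ hK, Real.log_lt_iff_lt_exp hCK] at hc₂
      have hI := impliedVol_mem_Ioo hx hT hK0 (wingVol_pos hT' hv₁ hK)
        (wingVol_pos hT' (hψ0.trans hv₂ψ) hK) (hb₁.trans hc₁) (hc₂.trans hb₂)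
      exact ⟨(wingVol_lt_iff hT' hv₁ hK (impliedVol_nonneg ..)).1 hI.1,
        (lt_wingVol_iff hT' hK (impliedVol_nonneg ..)).1 hI.2⟩
    obtain ⟨w₁, hw₁⟩ := exists_between hψ0
    obtain ⟨w₂, hw₂⟩ := exists_between hψ2
    refine tendsto_order.2 ⟨fun a ha => ?_, fun a ha => ?_⟩
    · filter_upwards [key (max a w₁) ⟨lt_max_of_lt_right hw₁.1, max_lt ha hw₁.2⟩ w₂ hw₂] with K hK
      exact (le_max_left _ _).trans_lt hK.1
    · filter_upwards [key w₁ hw₁ (min a w₂) ⟨lt_min ha hw₂.1, min_lt_of_right_lt hw₂.2⟩] with K hK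
      exact hK.2.trans_le (min_le_left _ _)

/-! ### Weak Pareto type and the exponent of a monotone function -/

/-- The exponent of a regularly varying function along the powers of `e`. Only the dilation by `e`
is used; the measurability of `f` would be needed for a limit along all reals. -/
lemma RegularlyVarying.tendsto_log_exp_nat {α : ℝ} {f : ℝ → ℝ} (hf : RegularlyVarying α f)
    (hpos : ∀ᶠ x in atTop, 0 < f x) :
    Tendsto (fun n : ℕ => Real.log (f (Real.exp n)) / n) atTop (𝓝 α) := by
  have hexp : Tendsto (fun n : ℕ => Real.exp n) atTop atTop :=
    Real.tendsto_exp_atTop.comp tendsto_natCast_atTop_atTop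
  have h1 : Tendsto (fun n : ℕ => Real.log (f (Real.exp (n + 1 : ℕ))) - Real.log (f (Real.exp n)))
      atTop (𝓝 α) := by
    have h := ((hf.2 (Real.exp 1) (Real.exp_pos 1)).comp hexp).log (by positivity)
    rw [Real.log_rpow (Real.exp_pos 1), Real.log_exp, mul_one] at h
    have hexp' : Tendsto (fun n : ℕ => Real.exp (n + 1 : ℕ)) atTop atTop :=
      hexp.comp (tendsto_add_atTop_nat 1)
    refine h.congr' ?_
    filter_upwards [hexp.eventually hpos, hexp'.eventually hpos] with n hn hn'
    have he : Real.exp 1 * Real.exp n = Real.exp (n + 1 : ℕ) := by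
      rw [← Real.exp_add]
      congr 1
      push_cast
      ring
    simp only [Function.comp_apply, he]
    exact Real.log_div hn'.ne' hn.ne'
  have h2 := h1.cesaro
  simp_rw [Finset.sum_range_sub (fun n : ℕ => Real.log (f (Real.exp n)))] at h2
  have h3 : Tendsto (fun n : ℕ => (n : ℝ)⁻¹ * Real.log (f (Real.exp (0 : ℕ)))) atTop (𝓝 0) := by
    simpa using tendsto_inv_atTop_nhds_zero_nat.mul_const (Real.log (f (Real.exp (0 : ℕ))))
  have h4 := h2.add h3
  rw [add_zero] at h4
  refine h4.congr fun n => ?_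
  rw [← mul_add, sub_add_cancel, inv_mul_eq_div]

/-- An antitone function inherits its exponent from its values at the powers of `e`. -/
lemma tendsto_log_div_log_of_nat {α : ℝ} {F : ℝ → ℝ} (hF : Antitone F)
    (hpos : ∀ᶠ x in atTop, 0 < F x)
    (h : Tendsto (fun n : ℕ => Real.log (F (Real.exp n)) / n) atTop (𝓝 α)) :
    Tendsto (fun x => Real.log (F x) / Real.log x) atTop (𝓝 α) := by
  have hfl : Tendsto (fun x => ⌊Real.log x⌋₊) atTop atTop :=
    tendsto_nat_floor_atTop.comp Real.tendsto_log_atTop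
  have hr : Tendsto (fun x => (⌊Real.log x⌋₊ : ℝ) / Real.log x) atTop (𝓝 1) :=
    (tendsto_nat_floor_div_atTop (R := ℝ)).comp Real.tendsto_log_atTop
  have hr' : Tendsto (fun x => ((⌊Real.log x⌋₊ + 1 : ℕ) : ℝ) / Real.log x) atTop (𝓝 1) := by
    have := hr.add (Real.tendsto_log_atTop.const_div_atTop 1)
    rw [add_zero] at this
    refine this.congr fun x => ?_
    push_cast
    rw [add_div]
  have hup := (h.comp hfl).mul hr
  have hlo := (h.comp ((tendsto_add_atTop_nat 1).comp hfl)).mul hr'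
  rw [mul_one] at hup hlo
  obtain ⟨a, ha⟩ := eventually_atTop.1 hpos
  refine tendsto_of_tendsto_of_tendsto_of_le_of_le' hlo hup ?_ ?_
  · filter_upwards [eventually_gt_atTop 0, eventually_ge_atTop a,
      Real.tendsto_log_atTop.eventually_gt_atTop 0] with x hx hxa hl
    have hlt : Real.log x < ((⌊Real.log x⌋₊ + 1 : ℕ) : ℝ) := by
      push_cast
      exact Nat.lt_floor_add_one _
    have hxe : x ≤ Real.exp (⌊Real.log x⌋₊ + 1 : ℕ) := (Real.log_le_iff_le_exp hx).1 hlt.le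
    simp only [Function.comp_apply]
    rw [div_mul_div_cancel₀ (hl.trans hlt).ne']
    gcongr
    · exact ha _ (hxa.trans hxe)
    · exact hF hxe
  · filter_upwards [eventually_gt_atTop 0, eventually_ge_atTop a,
      Real.tendsto_log_atTop.eventually_ge_atTop 1] with x hx hxa hl
    have hn : 0 < (⌊Real.log x⌋₊ : ℝ) := Nat.cast_pos.2 (Nat.floor_pos.2 hl)
    have hxe : Real.exp ⌊Real.log x⌋₊ ≤ x :=
      (Real.le_log_iff_exp_le hx).1 (Nat.floor_le (by linarith))
    simp only [Function.comp_apply]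
    rw [div_mul_div_cancel₀ hn.ne']
    gcongr
    · exact ha _ hxa
    · exact hF hxe

/-- Every `h(u) = o(u)` is dominated by a continuous function whose increments over intervals of a
fixed length vanish at infinity: the integral of `s ↦ sup_{t ≥ s} |h(t)| / t`. -/
lemma exists_continuous_majorant {h : ℝ → ℝ} (hh : Tendsto (fun u => h u / u) atTop (𝓝 0)) :
    ∃ g : ℝ → ℝ, Continuous g ∧ (∀ᶠ u in atTop, |h u| ≤ g u) ∧
      ∀ c, Tendsto (fun u => g (c + u) - g u) atTop (𝓝 0) := by
  -- The truncation at `1` keeps the supremum finite and is inactive near infinity.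
  set E : ℝ → ℝ := fun t => min |h t / t| 1 with hE
  have hE0 : ∀ t, 0 ≤ E t := fun t => le_min (abs_nonneg _) zero_le_one
  have hbdd : ∀ u, BddAbove (E '' Set.Ici u) :=
    fun u => ⟨1, by rintro _ ⟨t, -, rfl⟩; exact min_le_right _ _⟩
  set η : ℝ → ℝ := fun u => sSup (E '' Set.Ici u) with hη
  have hEη : ∀ u, E u ≤ η u := fun u => le_csSup (hbdd u) ⟨u, Set.self_mem_Ici, rfl⟩
  have hη0 : ∀ u, 0 ≤ η u := fun u => (hE0 u).trans (hEη u)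
  have hanti : Antitone η := fun u w huw => csSup_le_csSup (hbdd u)
    ⟨E w, w, Set.self_mem_Ici, rfl⟩ (Set.image_mono (Set.Ici_subset_Ici.2 huw))
  have hint : ∀ a b, IntervalIntegrable η volume a b :=
    fun a b => (hanti.antitoneOn _).intervalIntegrable
  have hlim : Tendsto η atTop (𝓝 0) := by
    refine tendsto_order.2 ⟨fun a ha => .of_forall fun u => ha.trans_le (hη0 u), fun a ha => ?_⟩
    obtain ⟨b, hb0, hba⟩ := exists_between ha
    have h0 := hh.abs
    rw [abs_zero] at h0
    obtain ⟨u₀, hu₀⟩ := eventually_atTop.1 (h0.eventually_lt_const hb0)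
    filter_upwards [eventually_ge_atTop u₀] with u hu
    refine lt_of_le_of_lt (csSup_le ⟨E u, u, Set.self_mem_Ici, rfl⟩ ?_) hba
    rintro _ ⟨t, ht, rfl⟩
    exact (min_le_left _ _).trans (hu₀ t (hu.trans ht)).le
  refine ⟨fun u => ∫ s in (0 : ℝ)..u, η s, intervalIntegral.continuous_primitive hint 0, ?_,
    fun c => ?_⟩
  · have h0 := hh.abs
    rw [abs_zero] at h0
    filter_upwards [eventually_gt_atTop 0, h0.eventually_lt_const one_pos] with u hu hu1
    have hEu : E u = |h u| / u := by
      rw [hE]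
      simp only
      rw [min_eq_left hu1.le, abs_div, abs_of_pos hu]
    calc |h u| = u * E u := by
          rw [hEu]
          field_simp
      _ ≤ u * η u := by
          gcongr
          exact hEη u
      _ = ∫ _ in (0 : ℝ)..u, η u := by simp
      _ ≤ _ := intervalIntegral.integral_mono_on hu.le (by simp) (hint _ _)
          fun s hs => hanti hs.2
  · have hmin : Tendsto (fun u => η (min (c + u) u) * |c|) atTop (𝓝 0) := by
      have : Tendsto (fun u : ℝ => min (c + u) u) atTop atTop :=
        tendsto_atTop.2 fun b => by
          filter_upwards [eventually_ge_atTop b, eventually_ge_atTop (b - c)] with u h1 h2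
          exact le_min (by linarith) h1
      simpa using (hlim.comp this).mul_const |c|
    refine squeeze_zero_norm (fun u => ?_) hmin
    rw [intervalIntegral.integral_interval_sub_left (hint _ _) (hint _ _)]
    have := intervalIntegral.norm_integral_le_of_norm_le_const (a := u) (b := c + u) (f := η)
      (C := η (min (c + u) u)) fun s hs => by
        rw [Real.norm_of_nonneg (hη0 s), min_comm]
        exact hanti hs.1.le
    simpa using this

lemma regularlyVarying_rpow_mul_exp {α : ℝ} {g : ℝ → ℝ} (hg : Continuous g)
    (hlim : ∀ c, Tendsto (fun u => g (c + u) - g u) atTop (𝓝 0)) :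
    RegularlyVarying α fun x => x ^ α * Real.exp (g (Real.log x)) := by
  refine ⟨⟨0, Measurable.aemeasurable ?_⟩, fun l hl => ?_⟩
  · exact (measurable_id.pow_const α).mul
      (Real.measurable_exp.comp (hg.measurable.comp Real.measurable_log))
  · have h := ((Real.continuous_exp.tendsto 0).comp
      ((hlim (Real.log l)).comp Real.tendsto_log_atTop)).const_mul (l ^ α)
    rw [Real.exp_zero, mul_one] at h
    refine h.congr' ?_
    filter_upwards [eventually_gt_atTop 0] with x hx
    simp only [Function.comp_apply]
    rw [Real.log_mul hl.ne' hx.ne', Real.mul_rpow hl.le hx.le, Real.exp_sub]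
    have : x ^ α ≠ 0 := (Real.rpow_pos_of_pos hx α).ne'
    field_simp

/-- An eventually positive antitone function is of weak Pareto type with index `α` if and only if
it is `x^{α + o(1)}`. -/
lemma weakParetoAtInfty_iff {α : ℝ} {F : ℝ → ℝ} (hF : Antitone F)
    (hpos : ∀ᶠ x in atTop, 0 < F x) :
    WeakParetoAtInfty α F ↔ Tendsto (fun x => Real.log (F x) / Real.log x) atTop (𝓝 α) := by
  constructor
  · rintro ⟨-, f₁, f₂, hf₁, hf₂, y₀, hy⟩
    have hev : ∀ᶠ y in atTop, 0 < f₁ y ∧ 0 < f₂ y ∧ f₁ y ≤ F y ∧ F y ≤ f₂ y :=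
      (eventually_gt_atTop y₀).mono hy
    have hexp : Tendsto (fun n : ℕ => Real.exp n) atTop atTop :=
      Real.tendsto_exp_atTop.comp tendsto_natCast_atTop_atTop
    refine tendsto_log_div_log_of_nat hF hpos (tendsto_of_tendsto_of_tendsto_of_le_of_le'
      (hf₁.tendsto_log_exp_nat (hev.mono fun y h => h.1))
      (hf₂.tendsto_log_exp_nat (hev.mono fun y h => h.2.1)) ?_ ?_)
    · filter_upwards [hexp.eventually hev] with n hn
      gcongr
      · exact hn.1
      · exact hn.2.2.1
    · filter_upwards [hexp.eventually hev] with n hn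
      gcongr
      · exact hn.1.trans_le hn.2.2.1
      · exact hn.2.2.2
  · intro h
    obtain ⟨a, ha⟩ := eventually_atTop.1 hpos
    refine ⟨⟨max a 0, le_max_right _ _, hF.measurable.aemeasurable,
      fun y hy => ha y ((le_max_left _ _).trans hy.le)⟩, ?_⟩
    -- In logarithmic coordinates, `F` differs from `x ^ α` by a factor `exp (o(u))`.
    have ho : Tendsto (fun u => (Real.log (F (Real.exp u)) - α * u) / u) atTop (𝓝 0) := by
      have h1 := (h.comp Real.tendsto_exp_atTop).sub_const α
      rw [sub_self] at h1
      refine h1.congr' ?_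
      filter_upwards [eventually_gt_atTop 0] with u hu
      simp only [Function.comp_apply, Real.log_exp]
      field_simp
    obtain ⟨g, hgc, hg, hglim⟩ := exists_continuous_majorant ho
    have hneg : ∀ c, Tendsto (fun u => -g (c + u) - -g u) atTop (𝓝 0) := fun c => by
      have := (hglim c).neg
      rw [neg_zero] at this
      exact this.congr fun u => by ring
    refine ⟨_, _, regularlyVarying_rpow_mul_exp (α := α) hgc.neg hneg,
      regularlyVarying_rpow_mul_exp (α := α) hgc hglim, ?_⟩
    obtain ⟨y₀, hy₀⟩ := eventually_atTop.1 ((Real.tendsto_log_atTop.eventually hg).and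
      (hpos.and (eventually_gt_atTop 0)))
    refine ⟨y₀, fun y hy => ?_⟩
    obtain ⟨hgy, hFy, hy0⟩ := hy₀ y hy.le
    rw [Real.exp_log hy0, abs_le] at hgy
    have hyα := Real.rpow_pos_of_pos hy0 α
    refine ⟨by positivity, by positivity, ?_, ?_⟩
    · rw [Real.rpow_def_of_pos hy0, ← Real.exp_add, ← Real.le_log_iff_exp_le hFy, Pi.neg_apply]
      linarith [hgy.1]
    · rw [Real.rpow_def_of_pos hy0, ← Real.exp_add, ← Real.log_le_iff_le_exp hFy]
      linarith [hgy.2]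

lemma antitone_callPrice {Ω : Type*} {m : MeasurableSpace Ω} (μ : Measure Ω) [IsFiniteMeasure μ]
    (r : ℝ) {X : ℝ≥0 → Ω → ℝ} {T : ℝ≥0} (hX : Integrable (X T) μ) :
    Antitone (callPrice μ r X T) := by
  have hint : ∀ K : ℝ, Integrable (fun ω => max (X T ω - K) 0) μ :=
    fun K => (hX.sub (integrable_const K)).pos_part
  intro K L hKL
  refine mul_le_mul_of_nonneg_left (integral_mono (hint L) (hint K) fun ω => ?_)
    (Real.exp_pos _).le
  exact max_le_max (by linarith) le_rfl

end OptionPricing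

theorem theorem5 {Ω : Type*} {m : MeasurableSpace Ω} (μ : Measure Ω) [IsProbabilityMeasure μ]
    (ℱ : Filtration ℝ≥0 m) (r x₀ : ℝ) (X : ℝ≥0 → Ω → ℝ)
    (hX : IsStockPrice μ ℱ r x₀ X)
    (hC : MemPFInfty r x₀ (callPrice μ r X))
    (T : ℝ≥0) (hT : 0 < T)
    (hp_pos : 0 < criticalMoment μ (X T)) (hp_fin : criticalMoment μ (X T) < ∞) :
    IsEquivalent atTop
        (fun K : ℝ => impliedVol r x₀ (callPrice μ r X) T K)
        (fun K : ℝ => (leePsi (criticalMoment μ (X T)).toReal / (T : ℝ)) ^ (1 / 2 : ℝ)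
          * √(Real.log K)) ↔
      WeakParetoAtInfty (-(criticalMoment μ (X T)).toReal) (fun K : ℝ => callPrice μ r X T K) := by
  have hx := hX.spot_pos
  have hp : 0 < (criticalMoment μ (X T)).toReal := ENNReal.toReal_pos hp_pos.ne' hp_fin.ne
  have hpos : ∀ᶠ K in atTop, 0 < callPrice μ r X T K := by
    filter_upwards [eventually_gt_atTop 0, eventually_ge_atTop (x₀ * Real.exp (r * T))]
      with K hK hK'
    exact hC T hT K hK hK'
  rw [isEquivalent_iff_tendsto_totalVariance (impliedVol_nonneg r x₀ _ T) (NNReal.coe_pos.2 hT)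
      (leePsi_mem_Ioo hp).1,
    tendsto_totalVariance_iff hx hT hp hpos,
    ← weakParetoAtInfty_iff (antitone_callPrice μ r (hX.integrable T)) hpos]
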